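/- Consider the following work-stealing scheduler executing a heterogeneous task dependency graph (HTDG). There are a finite set $D$ of domains (e.g. CPU, GPU) and a finite set $W$ of workers; each worker and each task belongs to one domain, and workers execute only tasks of their own domain. An HTDG is a locally finite directed graph, possibly with cycles; the edges out of condition tasks are weak, all others strong. A finished condition task returns an index and submits the successor with that index (nothing if there is none); any other finished task decrements the strong-dependency counter of each of its successors and submits those whose counter reaches $0$ (the counter of a task is reset to its number of strong dependencies when the task starts). Every worker owns one queue per domain, and there is one shared queue per domain. An external thread pushes each task without dependencies into the shared queue of its domain and then notifies one waiting worker of that domain. A submitted task is pushed into the submitting worker's queue for the task's domain $d$; if $d$ is not the worker's own domain and $\mathrm{actives}[d]=\mathrm{thieves}[d]=0$, one waiting worker of $d$ is notified. Each worker of domain $d$ repeats: (1) If it holds a task, it increments $\mathrm{actives}[d]$ and, if the result is $1$ and $\mathrm{thieves}[d]=0$, notifies one waiting worker of $d$; it executes the task and then the tasks popped from its own queue for $d$ until that queue is empty; it decrements $\mathrm{actives}[d]$. (2) It increments $\mathrm{thieves}[d]$. (3) It makes a round of at most $\mathrm{MAX\_STEALS}$ attempts to steal a task of $d$ from the queues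 for $d$ of arbitrary victims (other workers or the shared queue), until one succeeds. On success it decrements $\mathrm{thieves}[d]$, notifies one waiting worker of $d$ if the result is $0$, and returns to (1). (4) Otherwise it registers as waiting. If the shared queue for $d$ is nonempty, it unregisters and tries to steal from that queue, on success proceeding as in (3) and on failure returning to (3) without a new increment. Otherwise, if a stop signal has been given, it unregisters, notifies all waiting workers of all domains, decrements $\mathrm{thieves}[d]$ and leaves for good. Otherwise it decrements $\mathrm{thieves}[d]$; if the result is $0$ and either $\mathrm{actives}[d]>0$ or some worker's queue for $d$ is nonempty, it unregisters and returns to (2). In all other cases it sleeps until it has been notified, and returns to (2). The individual atomic operations of all workers and of the external thread interleave arbitrarily, and the stop signal may come at any time. Initially all queues are empty, all counters $\mathrm{actives}[d]$, $\mathrm{thieves}[d]$ are $0$, and all workers are about to perform (2). Each execution of a task takes time at most $E\ge 0$, each round of $\mathrm{MAX\_STEALS}\ge 1$ unsuccessful attempts in (3) takes time at least $e_s>0$, and all other operations of the workers are instantaneous. At a given moment, the number of wasteful steals in domain $d$ is the number of unsuccessful steal attempts that workers of $d$ have made, at times when no task of $d$ was in any queue, since a worker of $d$ last obtained a task from a queue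 (since the start, if none has). **Theorem.** At any moment of any execution of any HTDG, the number of wasteful steals, summed over all domains, is $$\mathcal{O}\bigl(\mathrm{MAX\_STEALS}\times(|W|+|D|\times(E/e_s))\bigr),$$ with an absolute constant, i.e. one that does not depend on the graph, the workers, the domains, the parameters, the execution or the moment. -/

import Mathlib

namespace WorkStealing

/-- A heterogeneous task dependency graph over a set `D` of domains, with set of tasks `T`.
The out-edges of a condition task are weak dependencies, all other edges are strong.
`succs t` is the ordered list of successors of `t`; cycles are allowed.  Only local finiteness is
required, so `T` may also hold the tasks that are spawned dynamically. -/
structure TaskGraph (D T : Type*) where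
  /-- the domain of a task (CPU, GPU, ...) -/
  domain : T → D
  /-- is the task a condition task (it returns the index of the next task to run)? -/
  isCondition : T → Prop
  /-- ordered successors -/
  succs : T → List T
  finite_preds : ∀ t, {p | t ∈ succs p}.Finite
  /-- the tasks without any dependency, strong or weak -/
  sources : List T
  nodup_sources : sources.Nodup
  mem_sources : ∀ t, t ∈ sources ↔ ∀ p, t ∉ succs p

/-- A scheduling problem: workers `W` distributed over the domains `D`, a task graph on `T`, and the
parameters of the scheduler. -/
structure Scheduler (W D T : Type*) where
  /-- the domain of a worker -/
  dom : W → D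
  /-- the graph that is executed -/
  graph : TaskGraph D T
  /-- number of steal attempts in one round of `explore_task` -/
  maxSteals : ℕ
  /-- maximum execution time of a task -/
  maxExec : ℝ
  /-- time that one (unsuccessful) round of `explore_task` takes at least -/
  roundTime : ℝ

/-- Program counter of a worker `w`; below `d` is the domain of `w`.
A task carried by a program counter is the value of the worker's pointer `t`, which is NIL at the
program counters that carry none (from `pop` on). -/
inductive PC (W D T : Type*) where
  -- exploit_task
  /-- `AtomInc(actives[d]) == 1 ?` -/
  | exploit (t : T)
  /-- `thieves[d] == 0 ?` -/
  | exploitCheck (t : T)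
  /-- `notifier[d].notify_one()` -/
  | exploitNotify (t : T)
  /-- about to call `execute_task` -/
  | invoke (t : T)
  /-- the callable of `t` has been running since time `start` -/
  | running (t : T) (start : ℝ)
  /-- the loop over the successors, `rest` of them still to be treated -/
  | release (rest : List T)
  /-- `t ← w.task_queue[d].pop()` -/
  | pop
  /-- `AtomDec(actives[d])` -/
  | decActives
  -- submit_task, called on `s`; afterwards the caller proceeds with `release rest`
  /-- `w.task_queue[d_s].push(s)` -/
  | submit (s : T) (rest : List T)
  /-- `actives[d_s] == 0 ?` -/
  | submitCheckActives (s : T) (rest : List T)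
  /-- `thieves[d_s] == 0 ?` -/
  | submitCheckThieves (s : T) (rest : List T)
  /-- `notifier[d_s].notify_one()` -/
  | submitNotify (s : T) (rest : List T)
  -- wait_for_task
  /-- `AtomInc(thieves[d])` -/
  | incThieves
  /-- call of `explore_task` -/
  | enterExplore
  /-- inside `explore_task`, entered at time `start`, after `steals` unsuccessful attempts -/
  | explore (steals : ℕ) (start : ℝ)
  /-- a task was stolen: `AtomDec(thieves[d]) == 0 ?` -/
  | stole (t : T)
  /-- `notifier[d].notify_one()` by the last thief, which has become active -/
  | stoleNotify (t : T)
  /-- `notifier[d].prepare_wait(w)` -/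
  | prepareWait
  /-- is the shared queue of `d` nonempty? -/
  | checkShared
  /-- `cancel_wait` because the shared queue was seen nonempty -/
  | cancelShared
  /-- `t ← task_queue[d].steal()` -/
  | stealShared
  /-- was the scheduler told to stop? -/
  | checkStop
  /-- `cancel_wait` because of the stop signal -/
  | cancelStop
  /-- `notify_all` in every domain, those in `rest` still to be treated -/
  | notifyStop (rest : Set D)
  /-- `AtomDec(thieves[d])` before leaving for good -/
  | decStop
  /-- the worker has left its loop -/
  | exited
  /-- `AtomDec(thieves[d]) == 0 ?` -/
  | decThieves
  /-- the last thief checks `actives[d] > 0` -/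
  | checkActives
  /-- the last thief checks the queues for `d` of the workers in `rest` -/
  | scan (rest : Set W)
  /-- `cancel_wait`, then back to the first line -/
  | cancelRetry
  /-- `notifier[d].commit_wait(w)`: sleep until notified -/
  | commitWait

/-- The external thread that executes `submit_graph`: it is about to push the first task of the
list, or to notify the given domain. -/
inductive ExtPC (D T : Type*) where
  | push (rest : List T)
  | notify (d : D) (rest : List T)

/-- Global state. The notifier of a domain is the set of the workers that have prepared or
committed to wait and have not been notified since. -/
structure Config (W D T : Type*) where
  now : ℝ
  pc : W → PC W D T
  ext : ExtPC D T
  /-- `localQ w d` is the queue of worker `w` for tasks of domain `d` -/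
  localQ : W → D → List T
  sharedQ : D → List T
  actives : D → ℤ
  thieves : D → ℤ
  /-- remaining strong dependencies -/
  strong : T → ℤ
  waiters : D → Set W
  stopFlag : Prop

/-- What is recorded about a step. -/
inductive Event (W : Type*) where
  /-- worker `w` obtained a task, by stealing it or from its own queue -/
  | acquire (w : W)
  /-- an unsuccessful steal attempt of worker `w` -/
  | fail (w : W)
  | silent

section

open scoped Classical

variable {W D T : Type*}

/-- Number of strong dependencies of a task. -/
noncomputable def TaskGraph.strongDependents (g : TaskGraph D T) (t : T) : ℕ :=
  ∑ᶠ p : T, if g.isCondition p then 0 else (g.succs p).count t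

/-- The tasks a finished task `t` has to treat next if its callable returned the index `r`
(meaningful for condition tasks only): submit the indexed successor, if there is one. -/
def TaskGraph.jump (g : TaskGraph D T) (t : T) (r : ℕ) : PC W D T :=
  match (g.succs t)[r]? with
  | some s => .submit s []
  | none => .pop

namespace Config

/-- The queue for domain `d` of a victim: a worker, or `none` for the shared queue. -/
def queue (c : Config W D T) (v : Option W) (d : D) : List T :=
  match v with
  | none => c.sharedQ d
  | some x => c.localQ x d

/-- Replace the queue for domain `d` of a victim. -/
noncomputable def setQueue (c : Config W D T) (v : Option W) (d : D) (q : List T) :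
    Config W D T :=
  match v with
  | none => { c with sharedQ := Function.update c.sharedQ d q }
  | some x =>
    { c with localQ := Function.update c.localQ x (Function.update (c.localQ x) d q) }

noncomputable def setPC (c : Config W D T) (w : W) (p : PC W D T) : Config W D T :=
  { c with pc := Function.update c.pc w p }

noncomputable def addActives (c : Config W D T) (d : D) (z : ℤ) : Config W D T :=
  { c with actives := Function.update c.actives d (c.actives d + z) }

noncomputable def addThieves (c : Config W D T) (d : D) (z : ℤ) : Config W D T :=
  { c with thieves := Function.update c.thieves d (c.thieves d + z) }

noncomputable def setStrong (c : Config W D T) (t : T) (z : ℤ) : Config W D T :=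
  { c with strong := Function.update c.strong t z }

noncomputable def setWaiters (c : Config W D T) (d : D) (s : Set W) : Config W D T :=
  { c with waiters := Function.update c.waiters d s }

/-- No task of domain `d` is in any queue. -/
def NoTask (c : Config W D T) (d : D) : Prop :=
  ∀ v : Option W, c.queue v d = []

end Config

/-- `notify_one` removes one (arbitrary) waiter, if there is any. -/
def NotifyOne (s s' : Set W) : Prop :=
  (s = ∅ ∧ s' = ∅) ∨ ∃ x ∈ s, s' = s \ {x}

namespace Scheduler

variable (S : Scheduler W D T)

/-- Initial state: all queues are empty, all workers enter their loop without a task, and the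
external thread is about to submit the graph. -/
noncomputable def initial : Config W D T where
  now := 0
  pc := fun _ => .incThieves
  ext := .push S.graph.sources
  localQ := fun _ _ => []
  sharedQ := fun _ => []
  actives := fun _ => 0
  thieves := fun _ => 0
  strong := fun t => S.graph.strongDependents t
  waiters := fun _ => ∅
  stopFlag := False

/-- Worker `w` lets time pass from `c.now` to `now'`: it is executing a task that has not used up
its time, it is inside a round of steal attempts, it sleeps, or it has left. All other operations
of a worker are instantaneous. -/
def MayWait (c : Config W D T) (now' : ℝ) (w : W) : Prop :=
  match c.pc w with
  | .running _ start => now' ≤ start + S.maxExec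
  | .explore _ _ => True
  | .commitWait => w ∈ c.waiters (S.dom w)
  | .exited => True
  | _ => False

/-- One atomic step. Steps of different workers interleave arbitrarily. -/
inductive Step : Config W D T → Event W → Config W D T → Prop
  -- time
  | tick (c : Config W D T) (now' : ℝ) (hnow : c.now ≤ now') (hw : ∀ w, S.MayWait c now' w) :
      Step c .silent { c with now := now' }
  -- environment: the stop signal may come at any time
  | signalStop (c : Config W D T) :
      Step c .silent { c with stopFlag := True }
  -- submit_graph
  | extPush (c : Config W D T) (t : T) (rest : List T) (h : c.ext = .push (t :: rest)) :
      Step c .silent { c.setQueue none (S.graph.domain t) (t :: c.sharedQ (S.graph.domain t)) with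
        ext := .notify (S.graph.domain t) rest }
  | extNotify (c : Config W D T) (d : D) (rest : List T) (s : Set W)
      (h : c.ext = .notify d rest) (hs : NotifyOne (c.waiters d) s) :
      Step c .silent { c.setWaiters d s with ext := .push rest }
  -- exploit_task
  | exploit (c : Config W D T) (w : W) (t : T) (h : c.pc w = .exploit t) :
      Step c .silent ((c.addActives (S.dom w) 1).setPC w
        (if c.actives (S.dom w) + 1 = 1 then .exploitCheck t else .invoke t))
  | exploitCheck (c : Config W D T) (w : W) (t : T) (h : c.pc w = .exploitCheck t) :
      Step c .silent (c.setPC w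
        (if c.thieves (S.dom w) = 0 then .exploitNotify t else .invoke t))
  | exploitNotify (c : Config W D T) (w : W) (t : T) (s : Set W)
      (h : c.pc w = .exploitNotify t) (hs : NotifyOne (c.waiters (S.dom w)) s) :
      Step c .silent ((c.setWaiters (S.dom w) s).setPC w (.invoke t))
  | popSome (c : Config W D T) (w : W) (t : T) (q : List T) (h : c.pc w = .pop)
      (hq : c.localQ w (S.dom w) = t :: q) :
      Step c (.acquire w) ((c.setQueue (some w) (S.dom w) q).setPC w (.invoke t))
  | popNone (c : Config W D T) (w : W) (h : c.pc w = .pop)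
      (hq : c.localQ w (S.dom w) = []) :
      Step c .silent (c.setPC w .decActives)
  | decActives (c : Config W D T) (w : W) (h : c.pc w = .decActives) :
      Step c .silent ((c.addActives (S.dom w) (-1)).setPC w .incThieves)
  -- execute_task; its counter of strong dependencies is re-armed when a task starts, so that it
  -- can be run again in a cyclic control flow
  | invoke (c : Config W D T) (w : W) (t : T) (h : c.pc w = .invoke t) :
      Step c .silent ((c.setStrong t (S.graph.strongDependents t)).setPC w (.running t c.now))
  | finishCondition (c : Config W D T) (w : W) (t : T) (start : ℝ) (r : ℕ)
      (h : c.pc w = .running t start) (ht : S.graph.isCondition t) :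
      Step c .silent (c.setPC w (S.graph.jump t r))
  | finishOther (c : Config W D T) (w : W) (t : T) (start : ℝ)
      (h : c.pc w = .running t start) (ht : ¬ S.graph.isCondition t) :
      Step c .silent (c.setPC w (.release (S.graph.succs t)))
  | releaseNil (c : Config W D T) (w : W) (h : c.pc w = .release []) :
      Step c .silent (c.setPC w .pop)
  | releaseCons (c : Config W D T) (w : W) (s : T) (rest : List T)
      (h : c.pc w = .release (s :: rest)) :
      Step c .silent ((c.setStrong s (c.strong s - 1)).setPC w
        (if c.strong s - 1 = 0 then .submit s rest else .release rest))
  -- submit_task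
  | submit (c : Config W D T) (w : W) (s : T) (rest : List T) (h : c.pc w = .submit s rest) :
      Step c .silent ((c.setQueue (some w) (S.graph.domain s)
          (s :: c.localQ w (S.graph.domain s))).setPC w
        (if S.dom w ≠ S.graph.domain s then .submitCheckActives s rest else .release rest))
  | submitCheckActives (c : Config W D T) (w : W) (s : T) (rest : List T)
      (h : c.pc w = .submitCheckActives s rest) :
      Step c .silent (c.setPC w
        (if c.actives (S.graph.domain s) = 0 then .submitCheckThieves s rest else .release rest))
  | submitCheckThieves (c : Config W D T) (w : W) (s : T) (rest : List T)
      (h : c.pc w = .submitCheckThieves s rest) :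
      Step c .silent (c.setPC w
        (if c.thieves (S.graph.domain s) = 0 then .submitNotify s rest else .release rest))
  | submitNotify (c : Config W D T) (w : W) (s : T) (rest : List T) (s' : Set W)
      (h : c.pc w = .submitNotify s rest)
      (hs : NotifyOne (c.waiters (S.graph.domain s)) s') :
      Step c .silent ((c.setWaiters (S.graph.domain s) s').setPC w (.release rest))
  -- wait_for_task and explore_task
  | incThieves (c : Config W D T) (w : W) (h : c.pc w = .incThieves) :
      Step c .silent ((c.addThieves (S.dom w) 1).setPC w .enterExplore)
  | enterExplore (c : Config W D T) (w : W) (h : c.pc w = .enterExplore) :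
      Step c .silent (c.setPC w (.explore 0 c.now))
  | stealSome (c : Config W D T) (w : W) (k : ℕ) (start : ℝ) (v : Option W) (q : List T) (t : T)
      (h : c.pc w = .explore k start) (hk : k < S.maxSteals) (hv : v ≠ some w)
      (hq : c.queue v (S.dom w) = q ++ [t]) :
      Step c (.acquire w) ((c.setQueue v (S.dom w) q).setPC w (.stole t))
  | stealNone (c : Config W D T) (w : W) (k : ℕ) (start : ℝ) (v : Option W)
      (h : c.pc w = .explore k start) (hk : k < S.maxSteals) (hv : v ≠ some w)
      (hq : c.queue v (S.dom w) = []) :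
      Step c (.fail w) (c.setPC w (.explore (k + 1) start))
  | exploreEnd (c : Config W D T) (w : W) (k : ℕ) (start : ℝ)
      (h : c.pc w = .explore k start) (hk : S.maxSteals ≤ k)
      (htime : start + S.roundTime ≤ c.now) :
      Step c .silent (c.setPC w .prepareWait)
  | stole (c : Config W D T) (w : W) (t : T) (h : c.pc w = .stole t) :
      Step c .silent ((c.addThieves (S.dom w) (-1)).setPC w
        (if c.thieves (S.dom w) - 1 = 0 then .stoleNotify t else .exploit t))
  | stoleNotify (c : Config W D T) (w : W) (t : T) (s : Set W)
      (h : c.pc w = .stoleNotify t) (hs : NotifyOne (c.waiters (S.dom w)) s) :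
      Step c .silent ((c.setWaiters (S.dom w) s).setPC w (.exploit t))
  | prepareWait (c : Config W D T) (w : W) (h : c.pc w = .prepareWait) :
      Step c .silent
        ((c.setWaiters (S.dom w) (insert w (c.waiters (S.dom w)))).setPC w .checkShared)
  | checkShared (c : Config W D T) (w : W) (h : c.pc w = .checkShared) :
      Step c .silent (c.setPC w (if c.sharedQ (S.dom w) ≠ [] then .cancelShared else .checkStop))
  | cancelShared (c : Config W D T) (w : W) (h : c.pc w = .cancelShared) :
      Step c .silent
        ((c.setWaiters (S.dom w) (c.waiters (S.dom w) \ {w})).setPC w .stealShared)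
  | stealSharedSome (c : Config W D T) (w : W) (q : List T) (t : T) (h : c.pc w = .stealShared)
      (hq : c.sharedQ (S.dom w) = q ++ [t]) :
      Step c (.acquire w) ((c.setQueue none (S.dom w) q).setPC w (.stole t))
  | stealSharedNone (c : Config W D T) (w : W) (h : c.pc w = .stealShared)
      (hq : c.sharedQ (S.dom w) = []) :
      Step c (.fail w) (c.setPC w .enterExplore)
  | checkStop (c : Config W D T) (w : W) (h : c.pc w = .checkStop) :
      Step c .silent (c.setPC w (if c.stopFlag then .cancelStop else .decThieves))
  | cancelStop (c : Config W D T) (w : W) (h : c.pc w = .cancelStop) :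
      Step c .silent
        ((c.setWaiters (S.dom w) (c.waiters (S.dom w) \ {w})).setPC w (.notifyStop Set.univ))
  | notifyStop (c : Config W D T) (w : W) (rest : Set D) (d : D)
      (h : c.pc w = .notifyStop rest) (hd : d ∈ rest) :
      Step c .silent ((c.setWaiters d ∅).setPC w (.notifyStop (rest \ {d})))
  | notifyStopEnd (c : Config W D T) (w : W) (h : c.pc w = .notifyStop ∅) :
      Step c .silent (c.setPC w .decStop)
  | decStop (c : Config W D T) (w : W) (h : c.pc w = .decStop) :
      Step c .silent ((c.addThieves (S.dom w) (-1)).setPC w .exited)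
  | decThieves (c : Config W D T) (w : W) (h : c.pc w = .decThieves) :
      Step c .silent ((c.addThieves (S.dom w) (-1)).setPC w
        (if c.thieves (S.dom w) - 1 = 0 then .checkActives else .commitWait))
  | checkActives (c : Config W D T) (w : W) (h : c.pc w = .checkActives) :
      Step c .silent
        (c.setPC w (if 0 < c.actives (S.dom w) then .cancelRetry else .scan Set.univ))
  | scan (c : Config W D T) (w : W) (rest : Set W) (x : W)
      (h : c.pc w = .scan rest) (hx : x ∈ rest) :
      Step c .silent (c.setPC w
        (if c.localQ x (S.dom w) ≠ [] then .cancelRetry else .scan (rest \ {x})))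
  | scanEnd (c : Config W D T) (w : W) (h : c.pc w = .scan ∅) :
      Step c .silent (c.setPC w .commitWait)
  | cancelRetry (c : Config W D T) (w : W) (h : c.pc w = .cancelRetry) :
      Step c .silent
        ((c.setWaiters (S.dom w) (c.waiters (S.dom w) \ {w})).setPC w .incThieves)
  | commitWait (c : Config W D T) (w : W) (h : c.pc w = .commitWait)
      (hw : w ∉ c.waiters (S.dom w)) :
      Step c .silent (c.setPC w .incThieves)

/-- The states `c 0, …, c n` and the events `e 0, …, e (n - 1)` are the first `n` steps of an
execution. -/
def IsExecution (n : ℕ) (c : ℕ → Config W D T) (e : ℕ → Event W) : Prop :=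
  c 0 = S.initial ∧ ∀ i < n, S.Step (c i) (e i) (c (i + 1))

/-- The number of wasteful steals in domain `d` after `n` steps: the unsuccessful steal attempts
that workers of `d` have made, while there was no task of `d` in any queue, since a worker of `d`
last obtained a task. -/
noncomputable def wastefulSteals (n : ℕ) (c : ℕ → Config W D T) (e : ℕ → Event W) (d : D) : ℕ :=
  Set.ncard {i | i < n ∧ (∃ w, S.dom w = d ∧ e i = .fail w) ∧ (c i).NoTask d ∧
    ∀ j, i < j → j < n → ∀ w, S.dom w = d → e j ≠ .acquire w}

end Scheduler

end

end WorkStealing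

/-! Fix a domain `d` with `m` workers, let `M`, `E`, `r` be `maxSteals`, `maxExec`, `roundTime`, and
let the window run from the first to the last wasteful steal of `d`, starting at time `t₀`. No
worker of `d` obtains a task in it, and only such an acquisition could remove a task from a queue
for `d`; hence all these queues are empty throughout. So tasks of `d` that are still running end by
`t₀ + E`. As other operations take no time, workers notify `d` at time `t₀` only, except after the
stop signal. The external thread has at most one notification for `d` pending, since a further one
would follow a push.

A worker that fails a whole round therefore goes to sleep, unless it is the last thief and sees an
active worker, which is impossible after `t₀ + E`. When the number of thieves reaches 0, nobody in
`d` is inside a round, so a full round must pass before this happens again: there are at most `E / r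
+ 1` such occasions up to `t₀ + E`, each worth at most `M` further attempts.

The rest is amortized. `PC.potential` bounds the attempts a worker can still make, including a
reserve of `M` for the round it may run after being woken by the stop signal. It is at most `3 * M`,
and a pending external notification adds `M`. `InWindow` collects these facts, and `InWindow.step`
shows that every step preserves them. The outcome is `M * (3 * m + 2 + E / r)`, which is at most `5
* M * (m + E / r)` because a wasteful steal requires `m ≥ 1`; summation over the domains finishes.
-/

namespace WorkStealing

open scoped Classical

variable {W D T : Type*}

/-! ### Counters as sums over program counters -/

namespace PC

/-- The contribution of a worker to the counter `thieves` of its domain. -/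
def thief : PC W D T → ℤ
  | .enterExplore | .explore _ _ | .stole _ | .prepareWait | .checkShared | .cancelShared
  | .stealShared | .checkStop | .cancelStop | .notifyStop _ | .decStop | .decThieves => 1
  | _ => 0

/-- The contribution of a worker to the counter `actives` of its domain. -/
def active : PC W D T → ℤ
  | .exploitCheck _ | .exploitNotify _ | .invoke _ | .running _ _ | .release _ | .pop
  | .decActives | .submit _ _ | .submitCheckActives _ _ | .submitCheckThieves _ _
  | .submitNotify _ _ => 1
  | _ => 0

theorem thief_nonneg (p : PC W D T) : 0 ≤ p.thief := by
  cases p <;> simp [thief]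

end PC

theorem TaskGraph.jump_eq (g : TaskGraph D T) (t : T) (r : ℕ) :
    (g.jump t r : PC W D T) = .pop ∨ ∃ s, (g.jump t r : PC W D T) = .submit s [] := by
  unfold TaskGraph.jump
  split
  · exact Or.inr ⟨_, rfl⟩
  · exact Or.inl rfl

namespace Config

variable (c : Config W D T) (v : Option W) (d : D) (q : List T)

@[simp] theorem setQueue_now : (c.setQueue v d q).now = c.now := by cases v <;> rfl
@[simp] theorem setQueue_pc : (c.setQueue v d q).pc = c.pc := by cases v <;> rfl
@[simp] theorem setQueue_ext : (c.setQueue v d q).ext = c.ext := by cases v <;> rfl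
@[simp] theorem setQueue_actives : (c.setQueue v d q).actives = c.actives := by cases v <;> rfl
@[simp] theorem setQueue_thieves : (c.setQueue v d q).thieves = c.thieves := by cases v <;> rfl
@[simp] theorem setQueue_waiters : (c.setQueue v d q).waiters = c.waiters := by cases v <;> rfl
@[simp] theorem setQueue_stopFlag : (c.setQueue v d q).stopFlag = c.stopFlag := by
  cases v <;> rfl

theorem queue_setQueue (v' : Option W) (d' : D) :
    (c.setQueue v d q).queue v' d' = if v' = v ∧ d' = d then q else c.queue v' d' := by
  cases v <;> cases v' <;> simp [setQueue, queue, Function.update_apply]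
  grind

end Config

/-- Sum of a weight over the workers of a domain. -/
noncomputable def Scheduler.total [Fintype W] (S : Scheduler W D T) {A : Type*} [AddCommMonoid A]
    (d : D) (f : W → A) : A :=
  ∑ w, if S.dom w = d then f w else 0

namespace Scheduler

variable (S : Scheduler W D T)

theorem total_update [Fintype W] (f : PC W D T → ℤ) (pc : W → PC W D T) (w : W) (p : PC W D T) (d : D) :
    S.total d (fun x => f (Function.update pc w p x)) =
      S.total d (fun x => f (pc x)) + if d = S.dom w then f p - f (pc w) else 0 := by
  have key : ∀ g : W → ℤ, S.total d g = (if S.dom w = d then g w else 0) +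
      ∑ x ∈ Finset.univ.erase w, if S.dom x = d then g x else 0 := fun g =>
    (Finset.add_sum_erase Finset.univ (fun x => if S.dom x = d then g x else 0)
      (Finset.mem_univ w)).symm
  rw [key, key]
  have : ∑ x ∈ Finset.univ.erase w, (if S.dom x = d then f (Function.update pc w p x) else 0) =
      ∑ x ∈ Finset.univ.erase w, (if S.dom x = d then f (pc x) else 0) := by
    refine Finset.sum_congr rfl fun x hx => ?_
    rw [Function.update_of_ne (Finset.ne_of_mem_erase hx)]
  rw [this, Function.update_self]
  by_cases h : S.dom w = d
  · simp [h]
    ring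
  · simp [h, Ne.symm h]

/-- The counters agree with the program counters. -/
structure Consistent [Fintype W] (c : Config W D T) : Prop where
  thieves : ∀ d, c.thieves d = S.total d fun w => (c.pc w).thief
  actives : ∀ d, c.actives d = S.total d fun w => (c.pc w).active
  start_le : ∀ w t s, c.pc w = .running t s → s ≤ c.now
  cancelStop : ∀ w, c.pc w = .cancelStop → c.stopFlag
  notifyStop : ∀ w r, c.pc w = .notifyStop r → c.stopFlag

theorem consistent_initial [Fintype W] : S.Consistent S.initial := by
  constructor <;> simp [initial, total, PC.thief, PC.active]

variable {S}

/-- Reduces all the step rules to two shapes, environment steps and moves of a single worker, so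
that `Consistent` needs only two cases. -/
theorem Step.counters {c c' : Config W D T} {e : Event W} (h : S.Step c e c') :
    (c'.pc = c.pc ∧ c'.thieves = c.thieves ∧ c'.actives = c.actives ∧ c.now ≤ c'.now ∧
      (c.stopFlag → c'.stopFlag)) ∨
    ∃ w p, c'.pc = Function.update c.pc w p ∧ c'.now = c.now ∧ c'.stopFlag = c.stopFlag ∧
      (∀ d, c'.thieves d = c.thieves d + if d = S.dom w then p.thief - (c.pc w).thief else 0) ∧
      (∀ d, c'.actives d =
        c.actives d + if d = S.dom w then p.active - (c.pc w).active else 0) ∧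
      (∀ t s, p = .running t s → s ≤ c.now) ∧ (p = .cancelStop → c.stopFlag) ∧
      (∀ r, p = .notifyStop r → c.pc w = .cancelStop ∨ ∃ r', c.pc w = .notifyStop r') := by
  cases h
  case tick now' hnow hw => exact .inl ⟨rfl, rfl, rfl, hnow, id⟩
  case signalStop => exact .inl ⟨rfl, rfl, rfl, le_rfl, fun _ => trivial⟩
  case extPush => exact .inl ⟨by simp, by simp, by simp, by simp, by simp⟩
  case extNotify => exact .inl ⟨rfl, rfl, rfl, le_rfl, id⟩
  case finishCondition w t start r h ht =>
    refine .inr ⟨w, _, rfl, rfl, rfl, ?_⟩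
    rcases S.graph.jump_eq (W := W) t r with hj | ⟨s, hj⟩ <;>
      simp [hj, h, PC.thief, PC.active, Config.setPC]
  all_goals
    refine .inr ⟨_, _, by simp only [Config.setPC, Config.setQueue_pc]; rfl,
      by simp [Config.setPC, Config.setWaiters, Config.addThieves, Config.addActives,
        Config.setStrong],
      by simp [Config.setPC, Config.setWaiters, Config.addThieves, Config.addActives,
        Config.setStrong], fun d => ?_, fun d => ?_, ?_⟩
  all_goals
    try simp only [Config.setPC, Config.setWaiters, Config.addThieves, Config.addActives,
      Config.setStrong, Config.setQueue_thieves, Config.setQueue_actives, Function.update_apply]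
  all_goals
    first
    | (split_ifs <;> simp_all [PC.thief, PC.active])
    | simp [*]

theorem Consistent.step [Fintype W] {c c' : Config W D T} {e : Event W} (hc : S.Consistent c)
    (h : S.Step c e c') : S.Consistent c' := by
  obtain ⟨h1, h2, h3, h4, h5⟩ := hc
  rcases h.counters with ⟨hpc, ht, ha, hn, hs⟩ | ⟨w, p, hpc, hn, hs, ht, ha, k3, k4, k5⟩
  · constructor
    · rw [hpc, ht]; exact h1
    · rw [hpc, ha]; exact h2
    · rw [hpc]; exact fun w t s h => (h3 w t s h).trans hn
    · rw [hpc]; exact fun w h => hs (h4 w h)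
    · rw [hpc]; exact fun w r h => hs (h5 w r h)
  · have hx : ∀ x, c'.pc x = if x = w then p else c.pc x := fun x => by
      rw [hpc, Function.update_apply]
    constructor
    · intro d; rw [hpc, ht, h1, total_update]
    · intro d; rw [hpc, ha, h2, total_update]
    · intro x t s; rw [hx, hn]; split_ifs
      · exact k3 t s
      · exact h3 x t s
    · intro x; rw [hx, hs]; split_ifs
      · exact k4
      · exact h4 x
    · intro x r; rw [hx, hs]; split_ifs
      · intro h
        rcases k5 r h with h | ⟨r', h⟩
        · exact h4 w h
        · exact h5 w r' h
      · exact h5 x r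

/-- A push for `d` leaves a nonempty queue, and only an acquisition by a worker of `d` shortens one.
Emptiness thus propagates backwards in time. -/
theorem Step.noTask {c c' : Config W D T} {e : Event W} {d : D} (h : S.Step c e c')
    (he : ∀ w, S.dom w = d → e ≠ .acquire w) (hn : c'.NoTask d) : c.NoTask d := by
  have other : ∀ (v : Option W) (d' : D) (q : List T), d' ≠ d →
      (c.setQueue v d' q).NoTask d → c.NoTask d := fun v d' q hd hq x => by
    have := hq x
    rwa [Config.queue_setQueue, if_neg (fun h => hd h.2.symm)] at this
  cases h
  case extPush t rest h =>
    by_cases hd : S.graph.domain t = d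
    · have := hn none
      simp [Config.queue, Config.setQueue, hd] at this
    · exact other none _ _ hd hn
  case popSome w t q h hq => exact other (some w) _ _ (fun hd => he w hd rfl) hn
  case submit w s rest h =>
    by_cases hd : S.graph.domain s = d
    · have := hn (some w)
      simp [Config.queue, Config.setQueue, Config.setPC, hd] at this
    · exact other (some w) _ _ hd hn
  case stealSome w k start v q t h hk hv hq => exact other v _ _ (fun hd => he w hd rfl) hn
  case stealSharedSome w q t h hq => exact other none _ _ (fun hd => he w hd rfl) hn
  all_goals exact hn

theorem Step.noTask_of_fail {c c' : Config W D T} {d : D} {w : W} (h : S.Step c (.fail w) c')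
    (hn : c.NoTask d) : c'.NoTask d := by
  cases h <;> exact hn

end Scheduler

/-! ### Time constraints and the potential of a worker -/

namespace PC

/-- What holds of a worker while, since time `t₀`, no worker of `d` has obtained a task and all
queues for `d` have been empty; `own` says that the worker belongs to `d`. -/
def InTime (g : TaskGraph D T) (d : D) (own : Prop) (t₀ E now : ℝ) : PC W D T → Prop
  | .exploit _ | .exploitCheck _ | .exploitNotify _ | .invoke _ | .stole _ | .stoleNotify _ =>
    own → now ≤ t₀
  | .running _ s => own → s ≤ t₀ ∧ now ≤ t₀ + E
  | .release _ | .pop | .decActives | .submit _ _ => own → now ≤ t₀ + E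
  | .submitCheckActives s _ | .submitCheckThieves s _ | .submitNotify s _ =>
    (own → now ≤ t₀ + E) ∧ (g.domain s = d → now ≤ t₀)
  | _ => True

/-- The current round of steal attempts, if any, has begun at time `L` or later. -/
def InRound (L r now : ℝ) : PC W D T → Prop
  | .explore _ start => L ≤ start
  | .prepareWait | .checkShared | .checkStop | .decThieves => L + r ≤ now
  | _ => True

/-- A bound on the number of unsuccessful steal attempts that a worker can still make while no task
of its domain is in any queue, apart from those it makes because it was the last thief, or was
notified by the external thread.  Here `st` is the number of attempts that are reserved for the
round that follows a stop signal. -/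
noncomputable def potential (M st : ℕ) (t₀ E now : ℝ) (waiting : Prop) : PC W D T → ℕ
  -- A round begun before `t₀` may end at `t₀` itself, when pending notifications can still wake the
  -- worker: hence the extra `M`. A round begun at `t₀` or later ends strictly after `t₀`.
  | .explore k start => (M - k) + st + (if now ≤ t₀ ∧ start < t₀ then M else 0)
  | .stealShared | .cancelShared => M + 1 + st
  | .exited | .decStop | .notifyStop _ | .cancelStop => 0
  | .prepareWait => if now ≤ t₀ then M + st else st
  | .checkShared | .checkStop => if now ≤ t₀ then M + st else st + (if waiting then 0 else st)
  -- For a registered waiter after `t₀`, this `M` is the round that follows the stop signal. Once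
  -- unregistered early, it also needs a round now, so `st` is added.
  | .decThieves | .scan _ | .commitWait => M + (if waiting ∧ t₀ < now then 0 else st)
  | .checkActives => M + (if waiting ∧ t₀ + E < now then 0 else st)
  | _ => M + st

theorem inTime_of_eq (g : TaskGraph D T) (d : D) (own : Prop) {t₀ E : ℝ} (hE : 0 ≤ E)
    (p : PC W D T) (hp : ∀ t s, p = .running t s → s ≤ t₀) : p.InTime g d own t₀ E t₀ := by
  cases p <;> simp_all [InTime]

theorem InTime.le_of_active {g : TaskGraph D T} {d : D} {own : Prop} {t₀ E now : ℝ} (hE : 0 ≤ E)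
    {p : PC W D T} (hp : p.InTime g d own t₀ E now) (ho : own) (ha : p.active ≠ 0) :
    now ≤ t₀ + E := by
  cases p <;> simp_all [InTime, active] <;> linarith

theorem inRound_of_thief {p : PC W D T} (h : p.thief = 0) (L r now : ℝ) : p.InRound L r now := by
  cases p <;> simp_all [InRound, thief]

/-- The worst case is a round straddling `t₀`: its own attempts, the reserve, and a wake-up at `t₀`.
The single attempt on the shared queue is where `1 ≤ M` enters. -/
theorem potential_le {M st : ℕ} (hM : 1 ≤ M) (hst : st ≤ M) (t₀ E now : ℝ) (waiting : Prop)
    (p : PC W D T) : p.potential M st t₀ E now waiting ≤ 3 * M := by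
  cases p <;> simp only [potential] <;> (try split_ifs) <;> omega

/-- Says when losing a registration is free: up to time `t₀` the potential ignores registrations,
and after the stop signal the reserve is 0. -/
theorem potential_anti_waiting {M st : ℕ} {t₀ E now : ℝ} (hE : 0 ≤ E) {waiting waiting' : Prop}
    (h : now ≤ t₀ ∨ st = 0 ∨ (waiting → waiting')) (p : PC W D T) :
    p.potential M st t₀ E now waiting' ≤ p.potential M st t₀ E now waiting := by
  have hlt : t₀ + E < now → t₀ < now := fun h => by linarith
  have hle : t₀ < now → ¬ now ≤ t₀ := fun h => by linarith
  cases p <;> simp only [potential] <;> (try split_ifs) <;> first | omega | tauto | grind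

theorem potential_notify {M st : ℕ} (hst : st ≤ M) {t₀ E now : ℝ} {waiting : Prop}
    (p : PC W D T) :
    p.potential M st t₀ E now False ≤ p.potential M st t₀ E now waiting + M := by
  cases p <;> simp only [potential] <;> (try split_ifs) <;> omega

theorem potential_mono_reserve {M st st' : ℕ} (hst : st' ≤ st) {t₀ E now : ℝ} {waiting : Prop}
    (p : PC W D T) :
    p.potential M st' t₀ E now waiting ≤ p.potential M st t₀ E now waiting := by
  cases p <;> simp only [potential] <;> (try split_ifs) <;> omega

end PC

/-! ### The window invariant and its elementary transitions -/

theorem NotifyOne.exists_removed {s s' : Set W} (h : NotifyOne s s') :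
    s' = s ∨ ∃ x, s' = s \ {x} := by
  rcases h with ⟨rfl, rfl⟩ | ⟨x, -, rfl⟩
  · exact .inl rfl
  · exact .inr ⟨x, rfl⟩

namespace Scheduler

variable {S : Scheduler W D T}

theorem total_le_total_add [Fintype W] {d : D} {f f' : W → ℕ} (w : W) {a b : ℕ}
    (hx : ∀ x, S.dom x = d → x ≠ w → f' x ≤ f x)
    (hw : S.dom w = d → a + f' w ≤ f w + b) (hab : S.dom w ≠ d → a ≤ b) :
    a + S.total d f' ≤ S.total d f + b := by
  have key : ∀ g : W → ℕ, S.total d g = (if S.dom w = d then g w else 0) +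
      ∑ x ∈ Finset.univ.erase w, if S.dom x = d then g x else 0 := fun g =>
    (Finset.add_sum_erase Finset.univ (fun x => if S.dom x = d then g x else 0)
      (Finset.mem_univ w)).symm
  rw [key f, key f']
  have : ∑ x ∈ Finset.univ.erase w, (if S.dom x = d then f' x else 0) ≤
      ∑ x ∈ Finset.univ.erase w, (if S.dom x = d then f x else 0) := by
    refine Finset.sum_le_sum fun x hxm => ?_
    split_ifs with hd
    · exact hx x hd (Finset.ne_of_mem_erase hxm)
    · exact le_rfl
  by_cases h : S.dom w = d
  · have := hw h
    simp only [h, if_true]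
    omega
  · have := hab h
    simp only [h, if_false]
    omega

theorem total_le_total [Fintype W] {d : D} {f f' : W → ℕ} (h : ∀ x, S.dom x = d → f' x ≤ f x) :
    S.total d f' ≤ S.total d f := by
  refine Finset.sum_le_sum fun x _ => ?_
  split_ifs with hd
  · exact h x hd
  · exact le_rfl

variable (S)

/-- Attempts of a worker that are reserved for the time after the stop signal. -/
noncomputable def reserve (c : Config W D T) : ℕ := if c.stopFlag then 0 else S.maxSteals

theorem reserve_le (c : Config W D T) : S.reserve c ≤ S.maxSteals := by
  unfold reserve
  split_ifs <;> omega

/-- The potential of a worker of domain `d`. -/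
noncomputable def workerPotential (d : D) (t₀ : ℝ) (c : Config W D T) (w : W) : ℕ :=
  (c.pc w).potential S.maxSteals (S.reserve c) t₀ S.maxExec c.now (w ∈ c.waiters d)

/-- Attempts that a pending notification by the external thread may cause. -/
noncomputable def extPotential (d : D) (c : Config W D T) : ℕ :=
  if ∃ rest, c.ext = .notify d rest then S.maxSteals else 0

/-- The number of unsuccessful steal attempts in domain `d` that an event records. -/
noncomputable def failCount (d : D) (e : Event W) : ℕ :=
  if ∃ w, S.dom w = d ∧ e = .fail w then 1 else 0

@[simp] theorem failCount_silent (d : D) : S.failCount d .silent = 0 := by simp [failCount]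

@[simp] theorem failCount_acquire (d : D) (w : W) : S.failCount d (.acquire w) = 0 := by
  simp [failCount]

@[simp] theorem failCount_fail (d : D) (w : W) :
    S.failCount d (.fail w) = if S.dom w = d then 1 else 0 := by
  unfold failCount
  congr 1
  simp only [Event.fail.injEq, eq_iff_iff]
  exact ⟨fun ⟨x, hx, h⟩ => h ▸ hx, fun h => ⟨w, h, rfl⟩⟩

/-- Invariant of the executions during which no worker of `d` obtains a task and all queues for `d`
are empty, since time `t₀`.  `F` counts the unsuccessful steal attempts and `N` the occasions, not
later than `t₀ + S.maxExec`, on which the last thief stopped to be a thief. -/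
structure InWindow [Fintype W] (d : D) (t₀ : ℝ) (B F N : ℕ) (c : Config W D T) : Prop where
  le_now : t₀ ≤ c.now
  inTime : ∀ w, (c.pc w).InTime S.graph d (S.dom w = d) t₀ S.maxExec c.now
  rounds : N = 0 ∨ (((N : ℝ) - 1) * S.roundTime ≤ S.maxExec ∧
    t₀ + ((N : ℝ) - 1) * S.roundTime ≤ c.now ∧ ∀ w, S.dom w = d →
      (c.pc w).InRound (t₀ + ((N : ℝ) - 1) * S.roundTime) S.roundTime c.now)
  fails : F + (S.total d (S.workerPotential d t₀ c) + S.extPotential d c) ≤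
    B + S.maxSteals * N

variable {S} [Fintype W] {d : D} {t₀ : ℝ} {B F N : ℕ} {c c' : Config W D T}

/-- The worker `w` moves to `p`, and makes `f` unsuccessful steal attempts. -/
theorem InWindow.advance (hc : S.InWindow d t₀ B F N c) (hE : 0 ≤ S.maxExec) {w : W}
    {p : PC W D T} {f : ℕ} (hpc : c'.pc = Function.update c.pc w p) (hnow : c'.now = c.now)
    (hflag : c'.stopFlag = c.stopFlag) (hext : c'.ext = c.ext)
    (hwait : c.now ≤ t₀ ∨ c.stopFlag ∨ ∀ x, x ≠ w → x ∈ c.waiters d → x ∈ c'.waiters d)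
    (hin : (c.pc w).InTime S.graph d (S.dom w = d) t₀ S.maxExec c.now →
      p.InTime S.graph d (S.dom w = d) t₀ S.maxExec c.now)
    (hround : S.dom w = d → ∀ L, L ≤ c.now → (c.pc w).InRound L S.roundTime c.now →
      p.InRound L S.roundTime c.now)
    (hpot : S.dom w = d →
      f + p.potential S.maxSteals (S.reserve c) t₀ S.maxExec c.now (w ∈ c'.waiters d) ≤
        (c.pc w).potential S.maxSteals (S.reserve c) t₀ S.maxExec c.now (w ∈ c.waiters d))
    (hf : S.dom w ≠ d → f = 0) : S.InWindow d t₀ B (F + f) N c' := by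
  have hp : ∀ x, c'.pc x = if x = w then p else c.pc x := fun x => by
    rw [hpc, Function.update_apply]
  have hres : S.reserve c' = S.reserve c := by simp only [reserve, hflag]
  refine ⟨hnow ▸ hc.le_now, fun x => ?_, ?_, ?_⟩
  · rw [hp, hnow]
    split_ifs with h
    · exact h ▸ hin (hc.inTime w)
    · exact hc.inTime x
  · rcases hc.rounds with h | ⟨h1, h2, h3⟩
    · exact .inl h
    · refine .inr ⟨h1, hnow ▸ h2, fun x hx => ?_⟩
      rw [hp, hnow]
      split_ifs with h
      · subst h
        exact hround hx _ h2 (h3 x hx)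
      · exact h3 x hx
  · have key := total_le_total_add (S := S) (d := d) (f := S.workerPotential d t₀ c)
      (f' := S.workerPotential d t₀ c') w (a := f) (b := 0) (fun x _ hxw => ?_) (fun hw => ?_)
      (fun hw => (hf hw).le)
    · have hX : S.extPotential d c' = S.extPotential d c := by simp only [extPotential, hext]
      have := hc.fails
      omega
    · unfold workerPotential
      rw [hres, hnow, hp, if_neg hxw]
      refine PC.potential_anti_waiting hE ?_ _
      rcases hwait with h | h | h
      · exact .inl h
      · exact .inr (.inl (by simp [reserve, h]))
      · exact .inr (.inr (h x hxw))
    · unfold workerPotential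
      rw [hres, hnow, hp, if_pos rfl]
      exact hpot hw

/-- Time passes only while workers run a task, explore, sleep or have left; the constraints tied to
instantaneous operations are never exposed to a later time. -/
theorem InWindow.tick (hc : S.InWindow d t₀ B F N c) {now' : ℝ}
    (hnow : c.now ≤ now') (hw : ∀ w, S.MayWait c now' w) :
    S.InWindow d t₀ B F N { c with now := now' } := by
  have ht := hc.le_now
  refine ⟨ht.trans hnow, fun w => ?_, ?_, ?_⟩
  · have h1 := hw w
    have h2 := hc.inTime w
    unfold MayWait at h1
    dsimp only
    generalize c.pc w = p at h1 h2 ⊢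
    cases p <;> simp_all [PC.InTime]
    intro ho
    linarith [(h2 ho).1]
  · rcases hc.rounds with h | ⟨h1, h2, h3⟩
    · exact .inl h
    · refine .inr ⟨h1, h2.trans hnow, fun w hd => ?_⟩
      have h4 := hw w
      have h5 := h3 w hd
      unfold MayWait at h4
      dsimp only
      generalize c.pc w = p at h4 h5 ⊢
      cases p <;> simp_all [PC.InRound]
  · refine le_trans ?_ hc.fails
    have : S.total d (S.workerPotential d t₀ { c with now := now' }) ≤
        S.total d (S.workerPotential d t₀ c) := by
      refine total_le_total fun w _ => ?_
      have h4 := hw w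
      unfold MayWait at h4
      unfold workerPotential reserve
      dsimp only
      generalize c.pc w = p at h4 ⊢
      cases p <;> simp only [PC.potential] at h4 ⊢ <;> (try split_ifs) <;>
        first | omega | tauto | grind
    have hX : S.extPotential d { c with now := now' } = S.extPotential d c := rfl
    omega

theorem InWindow.signalStop (hc : S.InWindow d t₀ B F N c) :
    S.InWindow d t₀ B F N { c with stopFlag := True } := by
  refine ⟨hc.le_now, hc.inTime, hc.rounds, le_trans ?_ hc.fails⟩
  have : S.total d (S.workerPotential d t₀ { c with stopFlag := True }) ≤
      S.total d (S.workerPotential d t₀ c) :=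
    total_le_total fun w _ => PC.potential_mono_reserve (by simp [reserve]) _
  have hX : S.extPotential d { c with stopFlag := True } = S.extPotential d c := rfl
  omega

/-- Steps of the external thread. -/
theorem InWindow.extStep (hc : S.InWindow d t₀ B F N c)
    (hpc : c'.pc = c.pc) (hnow : c'.now = c.now) (hflag : c'.stopFlag = c.stopFlag)
    (hX : S.extPotential d c' ≤ S.extPotential d c)
    (hwait : c'.waiters d = c.waiters d ∨
      S.extPotential d c' + S.maxSteals ≤ S.extPotential d c ∧
        ∃ x, c'.waiters d = c.waiters d \ {x}) :
    S.InWindow d t₀ B F N c' := by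
  have hres : S.reserve c' = S.reserve c := by simp only [reserve, hflag]
  refine ⟨hnow ▸ hc.le_now, fun w => hpc ▸ hnow ▸ hc.inTime w, hpc ▸ hnow ▸ hc.rounds,
    le_trans ?_ hc.fails⟩
  rcases hwait with hw | ⟨hX', y, hy⟩
  · have : S.workerPotential d t₀ c' = S.workerPotential d t₀ c := by
      funext w
      simp only [workerPotential, hpc, hnow, hres, hw]
    rw [this]
    omega
  · have := total_le_total_add (S := S) (d := d) (f := S.workerPotential d t₀ c)
      (f' := S.workerPotential d t₀ c') y (a := 0) (b := S.maxSteals) (fun x _ hxy => ?_)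
      (fun _ => ?_) (fun _ => Nat.zero_le _)
    · omega
    · simp only [workerPotential, hpc, hnow, hres, hy, Set.mem_sdiff, Set.mem_singleton_iff, hxy,
        not_false_eq_true, and_true, le_refl]
    · simp only [workerPotential, hpc, hnow, hres, hy, Set.mem_sdiff, Set.mem_singleton_iff,
        not_true_eq_false, and_false, zero_add]
      exact PC.potential_notify (S.reserve_le c) _

/-- The last thief stops to be a thief while workers may still be executing tasks. -/
theorem InWindow.lastThief (hc : S.InWindow d t₀ B F N c) (hcons : S.Consistent c')
    {w : W} (hd : S.dom w = d) (h : c.pc w = .decThieves)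
    (hpc : c'.pc = Function.update c.pc w .checkActives) (hnow : c'.now = c.now)
    (hflag : c'.stopFlag = c.stopFlag) (hext : c'.ext = c.ext) (hwait : c'.waiters = c.waiters)
    (hth : c'.thieves d = 0) (htime : c.now ≤ t₀ + S.maxExec) :
    S.InWindow d t₀ B F (N + 1) c' := by
  have hp : ∀ x, c'.pc x = if x = w then .checkActives else c.pc x := fun x => by
    rw [hpc, Function.update_apply]
  have hres : S.reserve c' = S.reserve c := by simp only [reserve, hflag]
  refine ⟨hnow ▸ hc.le_now, fun x => ?_, .inr ?_, ?_⟩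
  · rw [hp, hnow]
    split_ifs
    · trivial
    · exact hc.inTime x
  · have hcast : ((N + 1 : ℕ) : ℝ) - 1 = N := by push_cast; ring
    rw [hcast, hnow]
    -- For `N > 0` the worker has completed a round begun after the previous lower bound, which
    -- gains one `roundTime`. The first occasion needs no gap.
    have key : t₀ + N * S.roundTime ≤ c.now := by
      rcases hc.rounds with h0 | ⟨-, -, h3⟩
      · simpa [h0] using hc.le_now
      · have := h3 w hd
        rw [h] at this
        simp only [PC.InRound] at this
        linarith
    refine ⟨by linarith, key, fun x hx => PC.inRound_of_thief ?_ _ _ _⟩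
    -- The summands are nonnegative, so a zero count means that no worker of `d` is inside a round,
    -- and the new bound on starting times is vacuous.
    rw [hcons.thieves, total, Finset.sum_eq_zero_iff_of_nonneg] at hth
    · simpa [hx] using hth x (Finset.mem_univ x)
    · intro y _
      split_ifs
      · exact PC.thief_nonneg _
      · exact le_rfl
  · have key := total_le_total_add (S := S) (d := d) (f := S.workerPotential d t₀ c)
      (f' := S.workerPotential d t₀ c') w (a := 0) (b := S.maxSteals) (fun x _ hxw => ?_)
      (fun _ => ?_) (fun _ => Nat.zero_le _)
    · have hX : S.extPotential d c' = S.extPotential d c := by simp only [extPotential, hext]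
      have := hc.fails
      rw [mul_add]
      omega
    · simp only [workerPotential, hres, hnow, hp, hwait, if_neg hxw, le_refl]
    -- The potential may grow by the reserve here; the increment of `N` pays for it.
    · have := S.reserve_le c
      simp only [workerPotential, hres, hnow, hp, hwait, h, if_true, PC.potential]
      split_ifs <;> omega

end Scheduler

/-! ### Preservation of the invariant by every step -/

namespace Scheduler

variable {S : Scheduler W D T} [Fintype W] {d : D} {t₀ : ℝ} {B F N : ℕ} {c c' : Config W D T}
  {e : Event W}

theorem Consistent.exists_active (hc : S.Consistent c) (h : 0 < c.actives d) :
    ∃ w, S.dom w = d ∧ (c.pc w).active ≠ 0 := by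
  by_contra! hn
  rw [hc.actives, total, Finset.sum_eq_zero] at h
  · exact lt_irrefl _ h
  · intro w _
    split_ifs with hd
    · exact hn w hd
    · rfl

theorem InWindow.step (hc : S.InWindow d t₀ B F N c) (hcons : S.Consistent c)
    (hE : 0 ≤ S.maxExec) (hr : 0 < S.roundTime) (h : S.Step c e c')
    (he : ∀ w, S.dom w = d → e ≠ .acquire w) (hn : c.NoTask d) (hn' : c'.NoTask d) :
    ∃ N', S.InWindow d t₀ B (F + S.failCount d e) N' c' := by
  have hcons' := hcons.step h
  have hle := hc.le_now
  cases h
  case tick now' hnow hw => exact ⟨N, by simpa using hc.tick hnow hw⟩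
  case signalStop => exact ⟨N, by simpa using hc.signalStop⟩
  case extPush t rest h =>
    refine ⟨N, ?_⟩
    have hd : S.graph.domain t ≠ d := fun hd => by
      have := hn' none
      simp [Config.queue, Config.setQueue, hd] at this
    rw [failCount_silent, add_zero]
    refine hc.extStep (by simp) (by simp) (by simp) ?_ (.inl (by simp))
    simp [extPotential, hd]
  case extNotify d' rest s h hs =>
    refine ⟨N, ?_⟩
    rw [failCount_silent, add_zero]
    by_cases hd : d = d'
    · subst hd
      refine hc.extStep rfl rfl rfl (by simp [extPotential]) ?_
      rcases hs.exists_removed with rfl | ⟨x, rfl⟩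
      · exact .inl (by simp [Config.setWaiters])
      · exact .inr ⟨by simp [extPotential, h],
          x, by simp [Config.setWaiters]⟩
    · refine hc.extStep rfl rfl rfl (by simp [extPotential]) (.inl ?_)
      simp [Config.setWaiters, hd]
  case decThieves w h =>
    -- Only last thieves up to `t₀ + S.maxExec` are charged to `N`. A later one will find no active
    -- worker, so its potential does not grow.
    by_cases hlast : S.dom w = d ∧ c.thieves (S.dom w) - 1 = 0 ∧ c.now ≤ t₀ + S.maxExec
    · obtain ⟨hd, hth, htime⟩ := hlast
      refine ⟨N + 1, ?_⟩
      rw [failCount_silent, add_zero]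
      refine hc.lastThief hcons' hd h (by simp [hth, Config.setPC, Config.addThieves])
        rfl rfl rfl rfl ?_ htime
      subst hd
      simpa [Config.setPC, Config.addThieves, ← sub_eq_add_neg] using hth
    · refine ⟨N, hc.advance hE (w := w) rfl rfl rfl rfl (.inr (.inr fun x _ hx => hx)) ?_ ?_ ?_
        (fun _ => failCount_silent S d)⟩
      · intro _
        split_ifs <;> trivial
      · intro _ L _ _
        split_ifs <;> trivial
      · intro hd
        rw [h, failCount_silent]
        split_ifs with hth
        · have htime : t₀ + S.maxExec < c.now := not_le.mp fun ht => hlast ⟨hd, hth, ht⟩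
          have : t₀ < c.now := by linarith
          simp [PC.potential, Config.setPC, Config.addThieves, htime, this]
        · exact (Nat.zero_add _).le
  case checkActives w h =>
    refine ⟨N, hc.advance hE (w := w) rfl rfl rfl rfl (.inr (.inr fun x _ hx => hx)) ?_ ?_ ?_ ?_⟩
    · intro _; split_ifs <;> trivial
    · intro _ L _ _; split_ifs <;> trivial
    · intro hd
      have := S.reserve_le c
      rw [failCount_silent, h]
      split_ifs with ha
      -- An active worker in `d` forces the time to be at most `t₀ + S.maxExec`, where
      -- `checkActives` still carries the cost of a new round.
      · subst hd
        obtain ⟨x, hx, hax⟩ := hcons.exists_active ha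
        have := (hc.inTime x).le_of_active hE hx hax
        simp [PC.potential, not_lt.mpr this]
      · have : t₀ + S.maxExec < c.now → t₀ < c.now := fun h => by linarith
        simp only [PC.potential, Config.setPC]
        grind
    · simp
  case exploitNotify w t s h hs =>
    have hin := hc.inTime w
    rw [h] at hin
    refine ⟨N, hc.advance hE (w := w) rfl rfl rfl rfl ?_ (fun _ => hin) (fun _ L _ _ => trivial)
      ?_ (fun _ => failCount_silent S d)⟩
    -- A worker of `d` can be here only at time `t₀`, when removing a waiter is free.
    · by_cases hd : S.dom w = d
      · exact .inl (hin hd)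
      · exact .inr (.inr fun x _ hx => by
          simpa [Config.setPC, Config.setWaiters, Function.update_apply, Ne.symm hd] using hx)
    · simp [h, PC.potential]
  case stoleNotify w t s h hs =>
    have hin := hc.inTime w
    rw [h] at hin
    refine ⟨N, hc.advance hE (w := w) rfl rfl rfl rfl ?_ (fun _ => hin) (fun _ L _ _ => trivial)
      ?_ (fun _ => failCount_silent S d)⟩
    · by_cases hd : S.dom w = d
      · exact .inl (hin hd)
      · exact .inr (.inr fun x _ hx => by
          simpa [Config.setPC, Config.setWaiters, Function.update_apply, Ne.symm hd] using hx)
    · simp [h, PC.potential]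
  case submitNotify w s rest s' h hs =>
    have hin := hc.inTime w
    rw [h] at hin
    refine ⟨N, hc.advance hE (w := w) rfl rfl rfl rfl ?_ (fun _ => hin.1)
      (fun _ L _ _ => trivial) ?_ (fun _ => failCount_silent S d)⟩
    -- If `s` belongs to `d`, its push predates the window, so the time is still `t₀`.
    · by_cases hd : S.graph.domain s = d
      · exact .inl (hin.2 hd)
      · exact .inr (.inr fun x _ hx => by
          simpa [Config.setPC, Config.setWaiters, Function.update_apply, Ne.symm hd] using hx)
    · simp [h, PC.potential]
  case notifyStop w rest d' h hd =>
    refine ⟨N, hc.advance hE (w := w) rfl rfl rfl rfl (.inr (.inl (hcons.notifyStop w rest h)))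
      (fun _ => trivial) (fun _ L _ _ => trivial) ?_ (fun _ => failCount_silent S d)⟩
    simp [h, PC.potential]
  case submit w s rest h =>
    have hd : S.graph.domain s ≠ d := fun hd => by
      have := hn' (some w)
      simp [Config.queue, Config.setQueue, Config.setPC, hd] at this
    refine ⟨N, hc.advance hE (w := w) rfl rfl rfl rfl (.inr (.inr fun x _ hx => hx)) ?_ ?_ ?_
      (fun _ => failCount_silent S d)⟩
    · rw [h]
      intro hin
      split_ifs
      · exact ⟨hin, fun h => absurd h hd⟩
      · exact hin
    · intro _ L _ _
      split_ifs <;> trivial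
    · intro _
      rw [h]
      split_ifs <;> simp [PC.potential]
  case finishCondition w t start r h ht =>
    refine ⟨N, hc.advance hE (w := w) rfl rfl rfl rfl (.inr (.inr fun x _ hx => hx)) ?_ ?_ ?_
      (fun _ => failCount_silent S d)⟩
    · rw [h]
      intro hin
      rcases S.graph.jump_eq (W := W) t r with hj | ⟨s, hj⟩ <;> rw [hj] <;>
        exact fun ho => (hin ho).2
    · intro _ L _ _
      rcases S.graph.jump_eq (W := W) t r with hj | ⟨s, hj⟩ <;> rw [hj] <;> trivial
    · rcases S.graph.jump_eq (W := W) t r with hj | ⟨s, hj⟩ <;> simp [h, hj, PC.potential]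
  case popSome w t q h hq =>
    have hd : S.dom w ≠ d := fun hd => he w hd rfl
    exact ⟨N, hc.advance hE (w := w) rfl rfl rfl rfl (.inr (.inr fun x _ hx => hx))
      (fun _ ho => absurd ho hd) (fun ho => absurd ho hd) (fun ho => absurd ho hd)
      (fun _ => failCount_acquire S d w)⟩
  case stealSome w k start v q t h hk hv hq =>
    have hd : S.dom w ≠ d := fun hd => he w hd rfl
    exact ⟨N, hc.advance hE (w := w) (p := .stole t) (by simp [Config.setPC])
      (by simp [Config.setPC]) (by simp [Config.setPC]) (by simp [Config.setPC])
      (.inr (.inr fun x _ hx => by simpa [Config.setPC] using hx))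
      (fun _ ho => absurd ho hd) (fun ho => absurd ho hd) (fun ho => absurd ho hd)
      (fun _ => failCount_acquire S d w)⟩
  case stealSharedSome w q t h hq =>
    have hd : S.dom w ≠ d := fun hd => he w hd rfl
    exact ⟨N, hc.advance hE (w := w) rfl rfl rfl rfl (.inr (.inr fun x _ hx => hx))
      (fun _ ho => absurd ho hd) (fun ho => absurd ho hd) (fun ho => absurd ho hd)
      (fun _ => failCount_acquire S d w)⟩
  case stealNone w k start v h hk hv hq =>
    refine ⟨N, hc.advance hE (w := w) rfl rfl rfl rfl (.inr (.inr fun x _ hx => hx))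
      (fun _ => trivial) ?_ ?_ (fun hd => by simp [hd])⟩
    · rw [h]
      exact fun _ L _ hL => hL
    · intro hd
      rw [h, failCount_fail, if_pos hd]
      simp only [PC.potential]
      omega
  case stealSharedNone w h hq =>
    refine ⟨N, hc.advance hE (w := w) rfl rfl rfl rfl (.inr (.inr fun x _ hx => hx))
      (fun _ => trivial) (fun _ L _ _ => trivial) ?_ (fun hd => by simp [hd])⟩
    intro hd
    rw [h, failCount_fail, if_pos hd]
    simp only [PC.potential]
    omega
  case scan w rest x h hx =>
    refine ⟨N, hc.advance hE (w := w) rfl rfl rfl rfl (.inr (.inr fun x _ hx => hx)) ?_ ?_ ?_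
      (fun _ => failCount_silent S d)⟩
    · intro _
      split_ifs <;> trivial
    · intro _ L _ _
      split_ifs <;> trivial
    · intro hd
      have hq : c.localQ x (S.dom w) = [] := hd ▸ hn (some x)
      simp [h, hq, PC.potential, Config.setPC]
  case checkShared w h =>
    refine ⟨N, hc.advance hE (w := w) rfl rfl rfl rfl (.inr (.inr fun x _ hx => hx)) ?_ ?_ ?_
      (fun _ => failCount_silent S d)⟩
    · intro _
      split_ifs <;> trivial
    · rw [h]
      intro _ L _ hL
      split_ifs
      · trivial
      · exact hL
    · intro hd
      have hq : c.sharedQ (S.dom w) = [] := hd ▸ hn none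
      simp [h, hq, PC.potential, Config.setPC]
  all_goals
    refine ⟨N, hc.advance hE rfl rfl rfl rfl (.inr (.inr ?_)) ?_ ?_ ?_ ?_⟩
    · intro x hx hm
      simp only [Config.setPC, Config.setWaiters, Config.addThieves, Config.addActives,
        Config.setStrong, Function.update_apply]
      first
        | exact hm
        | (split_ifs <;> simp_all)
    · rw [‹c.pc _ = _›]
      try split_ifs
      all_goals simp [PC.InTime]
      all_goals grind
    · rw [‹c.pc _ = _›]
      intro _ L hL
      try split_ifs
      all_goals simp [PC.InRound]
      all_goals grind
    · rw [‹c.pc _ = _›, failCount_silent]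
      intro hd
      have := S.reserve_le c
      simp only [Config.setPC, Config.setWaiters, Config.addThieves, Config.addActives,
        Config.setStrong, Function.update_apply, hd, if_true]
      try split_ifs
      all_goals simp [PC.potential]
      all_goals grind [reserve]
    · intro _
      exact failCount_silent S d

end Scheduler

/-! ### From the invariant to the bound -/

namespace Scheduler

variable {S : Scheduler W D T} [Fintype W] {n : ℕ} {c : ℕ → Config W D T} {e : ℕ → Event W}
  {d : D}

theorem IsExecution.consistent (h : S.IsExecution n c e) {i : ℕ} (hi : i ≤ n) :
    S.Consistent (c i) := by
  induction i with
  | zero => exact h.1 ▸ S.consistent_initial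
  | succ i ih => exact (ih (by omega)).step (h.2 i hi)

theorem inWindow_start {c : Config W D T} (hc : S.Consistent c) (hM : 1 ≤ S.maxSteals)
    (hE : 0 ≤ S.maxExec) :
    S.InWindow d c.now (S.maxSteals * (3 * S.total d (fun _ => 1) + 1)) 0 0 c := by
  refine ⟨le_rfl, fun w => PC.inTime_of_eq _ _ _ hE _ (hc.start_le w), .inl rfl, ?_⟩
  have h1 : S.total d (S.workerPotential d c.now c) ≤
      S.total d (fun _ => 3 * S.maxSteals) :=
    total_le_total fun w _ => PC.potential_le hM (S.reserve_le c) _ _ _ _ _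
  have h2 : S.total d (fun _ => 3 * S.maxSteals) =
      3 * S.maxSteals * S.total d (fun _ => 1) := by
    unfold total
    rw [Finset.mul_sum]
    refine Finset.sum_congr rfl fun w _ => ?_
    split_ifs <;> simp
  have h3 : S.extPotential d c ≤ S.maxSteals := by
    unfold extPotential
    split_ifs <;> omega
  calc _ ≤ 3 * S.maxSteals * S.total d (fun _ => 1) + S.maxSteals := by omega
    _ = _ := by ring

/-- Emptiness is assumed only at the end `m`; `Step.noTask` carries it back along the induction. -/
theorem IsExecution.inWindow (h : S.IsExecution n c e) (hM : 1 ≤ S.maxSteals)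
    (hE : 0 ≤ S.maxExec) (hr : 0 < S.roundTime) {a m : ℕ} (ham : a ≤ m) (hmn : m ≤ n)
    (he : ∀ j, a ≤ j → j < m → ∀ w, S.dom w = d → e j ≠ .acquire w) (hm : (c m).NoTask d) :
    ∃ N, S.InWindow d (c a).now (S.maxSteals * (3 * S.total d (fun _ => 1) + 1))
      (∑ j ∈ Finset.Ico a m, S.failCount d (e j)) N (c m) := by
  induction m, ham using Nat.le_induction with
  | base => exact ⟨0, by simpa using inWindow_start (h.consistent hmn) hM hE⟩
  | succ m ham ih =>
    have hstep := h.2 m hmn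
    have hem := he m ham (Nat.lt_succ_self m)
    have hm' := hstep.noTask hem hm
    obtain ⟨N, hN⟩ := ih (by omega) (fun j h1 h2 => he j h1 (by omega)) hm'
    rw [Finset.sum_Ico_succ_top ham]
    exact hN.step (h.consistent (by omega)) hE hr hstep hem hm' hm

theorem InWindow.fails_le {t₀ : ℝ} {B F N : ℕ} {c : Config W D T}
    (hc : S.InWindow d t₀ B F N c) (hE : 0 ≤ S.maxExec) (hr : 0 < S.roundTime) :
    (F : ℝ) ≤ B + S.maxSteals * (S.maxExec / S.roundTime + 1) := by
  have hN : (N : ℝ) ≤ S.maxExec / S.roundTime + 1 := by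
    rcases hc.rounds with h | ⟨h, -, -⟩
    · rw [h, Nat.cast_zero]
      positivity
    · rwa [← le_div_iff₀ hr, sub_le_iff_le_add] at h
  have hF : F ≤ B + S.maxSteals * N := le_trans (Nat.le_add_right _ _) hc.fails
  calc (F : ℝ) ≤ B + S.maxSteals * N := by exact_mod_cast hF
    _ ≤ _ := by gcongr

theorem IsExecution.wastefulSteals_le (h : S.IsExecution n c e) (hM : 1 ≤ S.maxSteals)
    (hE : 0 ≤ S.maxExec) (hr : 0 < S.roundTime) (d : D) :
    (S.wastefulSteals n c e d : ℝ) ≤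
      5 * (S.maxSteals * ((S.total d fun _ => 1 : ℕ) + S.maxExec / S.roundTime)) := by
  set A : Set ℕ := {i | i < n ∧ (∃ w, S.dom w = d ∧ e i = .fail w) ∧ (c i).NoTask d ∧
    ∀ j, i < j → j < n → ∀ w, S.dom w = d → e j ≠ .acquire w} with hA
  have hAfin : A.Finite := (Set.finite_lt_nat n).subset fun i hi => hi.1
  change ((A.ncard : ℕ) : ℝ) ≤ _
  have hq : 0 ≤ S.maxExec / S.roundTime := by positivity
  rcases A.eq_empty_or_nonempty with h0 | hne
  · rw [h0, Set.ncard_empty, Nat.cast_zero]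
    positivity
  obtain ⟨a, haA, hamin⟩ := hAfin.exists_minimal hne
  obtain ⟨b, hbA, hbmax⟩ := hAfin.exists_maximal hne
  obtain ⟨-, ⟨w, hw, hea⟩, -, hacq⟩ := haA
  have hle : ∀ i ∈ A, a ≤ i := fun i hi => (le_total a i).elim id (hamin hi)
  have hge : ∀ i ∈ A, i ≤ b := fun i hi => (le_total i b).elim id (hbmax hi)
  have hab := hle b hbA
  obtain ⟨hbn, ⟨wb, -, heb⟩, hnb, -⟩ := hbA
  -- The window must include step `b` itself, and a failed attempt changes no queue.
  have hend : (c (b + 1)).NoTask d := (heb ▸ h.2 b hbn).noTask_of_fail hnb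
  obtain ⟨N, hN⟩ := h.inWindow (d := d) hM hE hr (a := a) (m := b + 1) (by omega) hbn
    (fun j haj hjb x hx => by
      rcases haj.eq_or_lt with rfl | haj
      · simp [hea]
      · exact hacq j haj (by omega) x hx) hend
  have hcard : A.ncard ≤ ∑ j ∈ Finset.Ico a (b + 1), S.failCount d (e j) := by
    rw [Set.ncard_eq_toFinset_card A hAfin, Finset.card_eq_sum_ones]
    calc ∑ j ∈ hAfin.toFinset, 1 = ∑ j ∈ hAfin.toFinset, S.failCount d (e j) :=
          Finset.sum_congr rfl fun j hj => by
            rw [failCount, if_pos ((hAfin.mem_toFinset.mp hj).2.1)]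
      _ ≤ _ := Finset.sum_le_sum_of_subset fun j hj => by
            have hj := hAfin.mem_toFinset.mp hj
            exact Finset.mem_Ico.mpr ⟨hle j hj, Nat.lt_succ_of_le (hge j hj)⟩
  -- At least one worker exists, so the additive 2 (one from the external thread, one from `E / r +
  -- 1`) is absorbed, turning 3 into 5.
  have hpos : 1 ≤ S.total d (fun _ => 1) := by
    have := Finset.single_le_sum (f := fun x => if S.dom x = d then 1 else 0)
      (fun x _ => Nat.zero_le _) (Finset.mem_univ w)
    simpa [total, hw] using this
  have hcard' : (A.ncard : ℝ) ≤ _ := (Nat.cast_le.mpr hcard).trans (hN.fails_le hE hr)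
  have hpos' : (1 : ℝ) ≤ (S.total d (fun _ => 1) : ℕ) := by exact_mod_cast hpos
  refine hcard'.trans ?_
  push_cast
  calc _ = (S.maxSteals : ℝ) * (3 * (S.total d fun _ => 1 : ℕ) + 2 +
        S.maxExec / S.roundTime) := by ring
    _ ≤ S.maxSteals * (5 * ((S.total d fun _ => 1 : ℕ) + S.maxExec / S.roundTime)) := by
        gcongr
        linarith
    _ = _ := by ring

theorem sum_total_one [Fintype D] (S : Scheduler W D T) :
    ∑ d, S.total d (fun _ => 1) = Fintype.card W := by
  unfold total
  rw [Finset.sum_comm]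
  simp

end Scheduler

end WorkStealing

theorem mainTheorem1 :
    ∃ C : ℝ, 0 < C ∧
      ∀ (W D T : Type*) [Fintype W] [Fintype D] (S : WorkStealing.Scheduler W D T)
        (_hmax : 1 ≤ S.maxSteals) (_hE : 0 ≤ S.maxExec) (_hes : 0 < S.roundTime)
        (n : ℕ) (c : ℕ → WorkStealing.Config W D T) (e : ℕ → WorkStealing.Event W)
        (_hexec : S.IsExecution n c e),
        ((∑ d : D, S.wastefulSteals n c e d : ℕ) : ℝ) ≤
          C * (S.maxSteals *
            (Fintype.card W + Fintype.card D * (S.maxExec / S.roundTime))) := by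
  refine ⟨5, by norm_num, fun W D T _ _ S hM hE hr n c e hexec => ?_⟩
  have hsum : (∑ d, (S.total d (fun _ => 1) : ℕ) : ℝ) = Fintype.card W := by
    rw [← Nat.cast_sum, S.sum_total_one]
  rw [Nat.cast_sum]
  calc _ ≤ ∑ d, 5 * (S.maxSteals * (((S.total d fun _ => 1 : ℕ) : ℝ) +
        S.maxExec / S.roundTime)) :=
        Finset.sum_le_sum fun d _ => hexec.wastefulSteals_le hM hE hr d
    _ = _ := by
        rw [← Finset.mul_sum, ← Finset.mul_sum, Finset.sum_add_distrib, hsum, Finset.sum_const,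
          Finset.card_univ, nsmul_eq_mul]
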